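/- Let $\Bbbk$ be an infinite field, let $r,m,n$ be non-negative integers with $r\le\min\{m,n\}$, and let $Z=(z_{ij})$ be an $m\times n$ matrix of variables. Let $I_{r+1}(Z)\subseteq \Bbbk[Z]$ be the ideal generated by the $(r+1)$-minors of $Z$, and let $\mathcal M(r,[m]\times[n])$ be the matroid on the ground set $[m]\times[n]$ in which a subset $\Omega$ is independent if and only if $I_{r+1}(Z)\cap \Bbbk[z_{ij} : (i,j)\in\Omega]=0$; its bases are the maximal independent sets. An anti-diagonal path from $\xi_1$ to $\xi_2$ in $[m]\times[n]$ is a maximal chain with minimum $\xi_1$ and maximum $\xi_2$ for the partial order in which $(i,j)\le(\alpha,\beta)$ if and only if $i\le\alpha$ and $j\ge\beta$. A diagonal path is defined in the same way for the partial order in which $(i,j)\le(\alpha,\beta)$ if and only if $i\le\alpha$ and $j\le\beta$. (a) Let $\sigma$ be a permutation of $\{1,\dots,r\}$ and let $P_1,\dots,P_r$ be pairwise disjoint anti-diagonal paths, where $P_i$ goes from $(i,n)$ to $(m,\sigma(i))$. Then $P_1\cup\dots\cup P_r$ is a base of $\mathcal M(r,[m]\times[n])$. (b) Let $\sigma$ be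 a permutation of $\{1,\dots,r\}$ and let $P_1,\dots,P_r$ be pairwise disjoint diagonal paths, where $P_i$ goes from $(i,1)$ to $(m,n-r+\sigma(i))$. Then $P_1\cup\dots\cup P_r$ is a base of $\mathcal M(r,[m]\times[n])$. -/

import Mathlib

open MvPolynomial

/-! ### The determinantal ideal and its elimination ideals -/

/-- The generic `m × n` matrix `Z` of variables over `k`. -/
noncomputable def genericMatrix (k : Type*) [Field k] (m n : ℕ) :
    Matrix (Fin m) (Fin n) (MvPolynomial (Fin m × Fin n) k) :=
  Matrix.of fun i j => X (i, j)

/-- The determinantal ideal `I_t(Z)`, generated by all `t`-minors of the generic matrix `Z`. -/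
noncomputable def determinantalIdeal (k : Type*) [Field k] (t m n : ℕ) :
    Ideal (MvPolynomial (Fin m × Fin n) k) :=
  Ideal.span {p | ∃ (f : Fin t ↪o Fin m) (g : Fin t ↪o Fin n),
    p = ((genericMatrix k m n).submatrix f g).det}

/-- The elimination ideal `E_Ω = I_{r+1}(Z) ∩ k[Z_Ω]`, as an ideal of `k[Z_Ω]`. -/
noncomputable def eliminationIdeal (k : Type*) [Field k] (r m n : ℕ) (Ω : Set (Fin m × Fin n)) :
    Ideal (MvPolynomial Ω k) :=
  (determinantalIdeal k (r + 1) m n).comap (rename (Subtype.val : Ω → Fin m × Fin n))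

/-! ### Helper facts: the sets with zero elimination ideal satisfy the matroid axioms -/

/-- The `(Fin m × Fin r)`-part of the variables, as a generic `m × r` matrix. -/
noncomputable def genericLeft (k : Type*) [Field k] (r m n : ℕ) :
    Matrix (Fin m) (Fin r) (MvPolynomial ((Fin m × Fin r) ⊕ (Fin r × Fin n)) k) :=
  Matrix.of fun i l => X (Sum.inl (i, l))

/-- The `(Fin r × Fin n)`-part of the variables, as a generic `r × n` matrix. -/
noncomputable def genericRight (k : Type*) [Field k] (r m n : ℕ) :
    Matrix (Fin r) (Fin n) (MvPolynomial ((Fin m × Fin r) ⊕ (Fin r × Fin n)) k) :=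
  Matrix.of fun l j => X (Sum.inr (l, j))

/-- The product of a generic `m × r` and a generic `r × n` matrix. -/
noncomputable def genericProduct (k : Type*) [Field k] (r m n : ℕ) :
    Matrix (Fin m) (Fin n) (MvPolynomial ((Fin m × Fin r) ⊕ (Fin r × Fin n)) k) :=
  genericLeft k r m n * genericRight k r m n

/-- The substitution of the generic product of rank at most `r` for `Z`. -/
noncomputable def genericProductHom (k : Type*) [Field k] (r m n : ℕ) :
    MvPolynomial (Fin m × Fin n) k →ₐ[k] MvPolynomial ((Fin m × Fin r) ⊕ (Fin r × Fin n)) k :=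
  aeval fun w => genericProduct k r m n w.1 w.2

theorem det_submatrix_mul_eq_zero {R : Type*} [CommRing R] [IsDomain R] {r m n : ℕ}
    (A : Matrix (Fin m) (Fin r) R) (B : Matrix (Fin r) (Fin n) R)
    (f : Fin (r + 1) → Fin m) (g : Fin (r + 1) → Fin n) :
    ((A * B).submatrix f g).det = 0 := by
  by_contra h
  have h1 := Matrix.rank_of_det_ne_zero h
  have h2 : (A * B).submatrix f g = A.submatrix f id * B.submatrix id g := by
    ext i j; simp [Matrix.mul_apply]
  have h3 : (A.submatrix f id * B.submatrix id g).rank ≤ r :=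
    (Matrix.rank_mul_le_left _ _).trans (Matrix.rank_le_width _)
  rw [← h2, h1] at h3
  simp at h3

theorem exists_linearIndependent_rows {K : Type*} [Field K] {m n t : ℕ}
    (A : Matrix (Fin m) (Fin n) K) (ht : t ≤ A.rank) :
    ∃ f : Fin t ↪o Fin m, LinearIndependent K (A.submatrix f id).row := by
  classical
  obtain ⟨κ, a, ha, hs, hli⟩ := exists_linearIndependent' K A.row
  have : Finite κ := Finite.of_injective a ha
  have := Fintype.ofFinite κ
  rw [Matrix.rank_eq_finrank_span_row, ← hs, finrank_span_eq_card hli] at ht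
  obtain ⟨s, hs1, hs2⟩ := Finset.exists_subset_card_eq
    (s := Finset.univ.image a) (n := t)
    (by rwa [Finset.card_image_of_injective _ ha, Finset.card_univ])
  refine ⟨s.orderEmbOfFin hs2, ?_⟩
  have hmem : ∀ i, ∃ c, a c = s.orderEmbOfFin hs2 i := fun i => by
    have := hs1 (s.orderEmbOfFin_mem hs2 i)
    simpa using this
  choose c hc using hmem
  have hcinj : Function.Injective c := fun i j hij => by
    apply (s.orderEmbOfFin hs2).injective
    rw [← hc, ← hc, hij]
  have := hli.comp c hcinj
  convert! this using 1
  ext i j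
  change A (s.orderEmbOfFin hs2 i) j = A (a (c i)) j
  rw [hc]

theorem rank_le_of_minors_eq_zero {K : Type*} [Field K] {r m n : ℕ}
    (A : Matrix (Fin m) (Fin n) K)
    (h : ∀ (f : Fin (r + 1) ↪o Fin m) (g : Fin (r + 1) ↪o Fin n), (A.submatrix f g).det = 0) :
    A.rank ≤ r := by
  by_contra hr
  obtain ⟨f, hf⟩ := exists_linearIndependent_rows A (t := r + 1) (by omega)
  have h1 := hf.rank_matrix
  rw [← Matrix.rank_transpose, Fintype.card_fin] at h1
  obtain ⟨g, hg⟩ := exists_linearIndependent_rows _ h1.ge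
  rw [Matrix.linearIndependent_rows_iff_isUnit, Matrix.isUnit_iff_isUnit_det] at hg
  apply hg.ne_zero
  rw [← h f g, ← Matrix.det_transpose]
  rfl

theorem exists_eq_mul_of_rank_le {K : Type*} [Field K] {r m n : ℕ}
    (A : Matrix (Fin m) (Fin n) K) (h : A.rank ≤ r) :
    ∃ (B : Matrix (Fin m) (Fin r) K) (C : Matrix (Fin r) (Fin n) K), A = B * C := by
  let W := LinearMap.range A.mulVecLin
  have hW : Module.finrank K W ≤ r := h
  obtain ⟨e, he⟩ : ∃ e : W →ₗ[K] (Fin r → K), Function.Injective e :=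
    ⟨Function.ExtendByZero.linearMap K (Fin.castLE hW) ∘ₗ
      (Module.finBasis K W).equivFun.toLinearMap,
      fun x y hxy => (Module.finBasis K W).equivFun.injective <| by
        ext i
        have h1 := congrFun hxy (Fin.castLE hW i)
        change Function.extend (Fin.castLE hW) ((Module.finBasis K W).equivFun x) 0 (Fin.castLE hW i) =
          Function.extend (Fin.castLE hW) ((Module.finBasis K W).equivFun y) 0 (Fin.castLE hW i) at h1
        rwa [(Fin.castLE_injective hW).extend_apply, (Fin.castLE_injective hW).extend_apply] at h1⟩
  obtain ⟨g, hg⟩ := e.exists_leftInverse_of_injective (LinearMap.ker_eq_bot.2 he)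
  refine ⟨LinearMap.toMatrix' (W.subtype ∘ₗ g),
    LinearMap.toMatrix' (e ∘ₗ A.mulVecLin.rangeRestrict), ?_⟩
  rw [← LinearMap.toMatrix'_comp]
  have : (W.subtype ∘ₗ g) ∘ₗ e ∘ₗ A.mulVecLin.rangeRestrict = A.mulVecLin := by
    ext1 x
    have h1 := fun w => LinearMap.congr_fun hg w
    simp only [LinearMap.comp_apply, LinearMap.id_apply] at h1
    ext j
    simp [h1]
  rw [this, ← Matrix.toLin'_apply', LinearMap.toMatrix'_toLin']

theorem determinantalIdeal_le_ker (k : Type*) [Field k] (r m n : ℕ) :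
    determinantalIdeal k (r + 1) m n ≤ RingHom.ker (genericProductHom k r m n) := by
  rw [determinantalIdeal, Ideal.span_le]
  rintro _ ⟨f, g, rfl⟩
  rw [SetLike.mem_coe, RingHom.mem_ker, AlgHom.map_det]
  convert! det_submatrix_mul_eq_zero (genericLeft k r m n) (genericRight k r m n) f g using 2
  ext1 i j
  simp [genericMatrix, genericProductHom, genericProduct]

theorem ker_le_radical_determinantalIdeal (k : Type*) [Field k] (r m n : ℕ) :
    RingHom.ker (genericProductHom k r m n) ≤ (determinantalIdeal k (r + 1) m n).radical := by
  intro p hp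
  rw [Ideal.radical_eq_sInf, Ideal.mem_sInf]
  rintro P ⟨hIP, hP⟩
  let Q := MvPolynomial (Fin m × Fin n) k ⧸ P
  let K := FractionRing Q
  let π : MvPolynomial (Fin m × Fin n) k →ₐ[k] K :=
    (IsScalarTower.toAlgHom k Q K).comp (Ideal.Quotient.mkₐ k P)
  have hπ : ∀ q, π q = 0 ↔ q ∈ P := fun q => by
    change algebraMap Q K (Ideal.Quotient.mk P q) = 0 ↔ _
    rw [FaithfulSMul.algebraMap_eq_zero_iff, Ideal.Quotient.eq_zero_iff_mem]
  have hminor : ∀ (f : Fin (r + 1) ↪o Fin m) (g : Fin (r + 1) ↪o Fin n),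
      (((genericMatrix k m n).map π).submatrix f g).det = 0 := fun f g => by
    have h0 : π ((genericMatrix k m n).submatrix f g).det = 0 :=
      (hπ _).2 (hIP (Ideal.subset_span ⟨f, g, rfl⟩))
    rw [AlgHom.map_det] at h0
    exact h0
  obtain ⟨B, C, hBC⟩ := exists_eq_mul_of_rank_le (r := r) ((genericMatrix k m n).map π)
    (rank_le_of_minors_eq_zero _ hminor)
  let ψ : MvPolynomial ((Fin m × Fin r) ⊕ (Fin r × Fin n)) k →ₐ[k] K :=
    aeval (Sum.elim (fun w => B w.1 w.2) (fun w => C w.1 w.2))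
  have hψ : ψ.comp (genericProductHom k r m n) = π := by
    apply MvPolynomial.algHom_ext
    rintro ⟨i, j⟩
    have h1 := congrFun (congrFun hBC i) j
    simp only [Matrix.map_apply, genericMatrix, Matrix.of_apply] at h1
    rw [h1]
    rw [AlgHom.comp_apply, genericProductHom, aeval_X, genericProduct, Matrix.mul_apply,
      Matrix.mul_apply, map_sum]
    simp [ψ, genericLeft, genericRight]
  rw [← hπ, ← hψ, AlgHom.comp_apply, (RingHom.mem_ker).1 hp, map_zero]

theorem eliminationIdeal_eq_bot_iff (k : Type*) [Field k] (r m n : ℕ)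
    (Ω : Set (Fin m × Fin n)) :
    eliminationIdeal k r m n Ω = ⊥ ↔
      AlgebraicIndependent k fun w : Ω => genericProduct k r m n w.1.1 w.1.2 := by
  have key : ∀ p : MvPolynomial Ω k, genericProductHom k r m n (rename Subtype.val p) =
      aeval (fun w : Ω => genericProduct k r m n w.1.1 w.1.2) p := fun p => by
    rw [genericProductHom, aeval_rename]; rfl
  rw [algebraicIndependent_iff]
  constructor
  · intro h p hp
    rw [← key] at hp
    obtain ⟨N, hN⟩ := ker_le_radical_determinantalIdeal k r m n hp
    have : p ^ N ∈ eliminationIdeal k r m n Ω := by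
      rw [eliminationIdeal, Ideal.mem_comap, map_pow]; exact hN
    rw [h, Ideal.mem_bot] at this
    exact eq_zero_of_pow_eq_zero this
  · intro h
    rw [eq_bot_iff]
    intro p hp
    refine h p ?_
    rw [← key]
    exact determinantalIdeal_le_ker k r m n hp

theorem eliminationIdeal_eq_bot_iff_comap_indep (k : Type*) [Field k] (r m n : ℕ)
    (Ω : Set (Fin m × Fin n)) :
    eliminationIdeal k r m n Ω = ⊥ ↔
      ((AlgebraicIndependent.matroid k
        (MvPolynomial ((Fin m × Fin r) ⊕ (Fin r × Fin n)) k)).comap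
          fun w => genericProduct k r m n w.1 w.2).Indep Ω := by
  rw [eliminationIdeal_eq_bot_iff, Matroid.comap_indep_iff,
    AlgebraicIndependent.matroid_indep_iff]
  constructor
  · intro h
    have hinj : Set.InjOn (fun w => genericProduct k r m n w.1 w.2) Ω :=
      Set.injOn_iff_injective.2 h.injective
    exact ⟨(algebraicIndependent_image hinj).1 h, hinj⟩
  · rintro ⟨h, hinj⟩
    exact (algebraicIndependent_image hinj).2 h

/-! ### The determinantal matroid -/

/-- The determinantal matroid `M(r, [m] × [n])`: its ground set is `[m] × [n]`, and a subset `Ω` is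
independent if and only if the elimination ideal `E_Ω = I_{r+1}(Z) ∩ k[Z_Ω]` is zero. -/
noncomputable def determinantalMatroid (k : Type*) [Field k] (r m n : ℕ) :
    Matroid (Fin m × Fin n) :=
  (IndepMatroid.ofFinite (E := Set.univ) Set.finite_univ
    (Indep := fun Ω => eliminationIdeal k r m n Ω = ⊥)
    (indep_empty := by
      rw [eliminationIdeal_eq_bot_iff_comap_indep]
      exact Matroid.empty_indep _)
    (indep_subset := fun I J hJ hIJ => by
      rw [eliminationIdeal_eq_bot_iff_comap_indep] at hJ ⊢
      exact hJ.subset hIJ)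
    (indep_aug := fun I J hI hJ hlt => by
      simp only [eliminationIdeal_eq_bot_iff_comap_indep] at hI hJ ⊢
      obtain ⟨e, he, h⟩ := hI.augment hJ (by
        rw [← (Set.toFinite I).cast_ncard_eq, ← (Set.toFinite J).cast_ncard_eq]
        exact_mod_cast hlt)
      exact ⟨e, he.1, he.2, h⟩)
    (subset_ground := fun I _ => Set.subset_univ I)).matroid

theorem determinantalMatroid_ground (k : Type*) [Field k] (r m n : ℕ) :
    (determinantalMatroid k r m n).E = Set.univ :=
  rfl

theorem determinantalMatroid_indep_iff (k : Type*) [Field k] (r m n : ℕ)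
    (Ω : Set (Fin m × Fin n)) :
    (determinantalMatroid k r m n).Indep Ω ↔ eliminationIdeal k r m n Ω = ⊥ := by
  simp [determinantalMatroid]

/-! ### Diagonal and anti-diagonal paths -/

/-- The partial order `(i, j) ≤ (α, β)` iff `i ≤ α` and `j ≥ β`. -/
def antiDiagonalLE {m n : ℕ} (p q : Fin m × Fin n) : Prop :=
  p.1 ≤ q.1 ∧ q.2 ≤ p.2

/-- The partial order `(i, j) ≤ (α, β)` iff `i ≤ α` and `j ≤ β`. -/
def diagonalLE {m n : ℕ} (p q : Fin m × Fin n) : Prop :=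
  p.1 ≤ q.1 ∧ p.2 ≤ q.2

/-- `C` is a chain for the order `le` with minimum `a` and maximum `b`. -/
def IsChainFromTo {α : Type*} (le : α → α → Prop) (a b : α) (C : Set α) : Prop :=
  IsChain le C ∧ a ∈ C ∧ b ∈ C ∧ ∀ c ∈ C, le a c ∧ le c b

/-- `C` is a maximal chain, for the order `le`, among those with minimum `a` and maximum `b`. -/
def IsLatticePath {α : Type*} (le : α → α → Prop) (a b : α) (C : Set α) : Prop :=
  Maximal (IsChainFromTo le a b) C

/-- An anti-diagonal path from `a` to `b`. -/
def IsAntiDiagonalPath {m n : ℕ} (a b : Fin m × Fin n) (C : Set (Fin m × Fin n)) : Prop :=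
  IsLatticePath antiDiagonalLE a b C

/-- A diagonal path from `a` to `b`. -/
def IsDiagonalPath {m n : ℕ} (a b : Fin m × Fin n) (C : Set (Fin m × Fin n)) : Prop :=
  IsLatticePath diagonalLE a b C

section Endpoints

variable {r m n : ℕ}

/-- The point `(i, n)` (with rows and columns numbered from `1`), for `i = 1, …, r`. -/
def antiDiagonalSource (hm : r ≤ m) (hn : r ≤ n) (i : Fin r) : Fin m × Fin n :=
  (⟨i, by omega⟩, ⟨n - 1, by have := i.isLt; omega⟩)

/-- The point `(m, i)` (with rows and columns numbered from `1`), for `i = 1, …, r`. -/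
def antiDiagonalTarget (hm : r ≤ m) (hn : r ≤ n) (i : Fin r) : Fin m × Fin n :=
  (⟨m - 1, by have := i.isLt; omega⟩, ⟨i, by omega⟩)

/-- The point `(i, 1)` (with rows and columns numbered from `1`), for `i = 1, …, r`. -/
def diagonalSource (hm : r ≤ m) (hn : r ≤ n) (i : Fin r) : Fin m × Fin n :=
  (⟨i, by omega⟩, ⟨0, by have := i.isLt; omega⟩)

/-- The point `(m, n - r + i)` (with rows and columns numbered from `1`), for `i = 1, …, r`. -/
def diagonalTarget (hm : r ≤ m) (hn : r ≤ n) (i : Fin r) : Fin m × Fin n :=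
  (⟨m - 1, by have := i.isLt; omega⟩, ⟨n - r + i, by omega⟩)

end Endpoints

/-!
The `(r + 1)`-minors of `Z` cut out, up to radical, the matrices `A * B` with `A` of size `m × r` and
`B` of size `r × n`, so a set of positions is independent if and only if the corresponding entries
`∑ l, a_il * b_lj` of the generic product are algebraically independent.

Let `P_1, …, P_r` be disjoint anti-diagonal paths as in the theorem. A path with a later starting
point remains on the lower right of the earlier ones (`IsAntiDiagonalPath.not_le_of_disjoint`). Let
`c_s(i)` be the length of row `i` in the region on the upper left of `P_s`. Then a point `(i, j)` of
`P_t` satisfies `j < c_s(i)` exactly when `t ≤ s`. Give the monomial `a_il * b_lj` the weight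
`∑ s, if l ≤ s then 2 * c_s(i) else 2 * j + 1`, which is the sum of a weight of `a_il` and a weight
of `b_lj`. For `(i, j)` on `P_t` the choice `l = t` makes every term of this sum the larger of the
two alternatives, so `a_it * b_tj` is the leading monomial of the entry
(`hasLeadingMonomial_genericProduct`). In the bipartite graph on rows and columns a chain is a forest,
so these leading monomials are independent (`injective_sum_smul_productExponent`), and hence so are
the entries (`algebraicIndependent_of_hasLeadingMonomial`).

It remains to compare cardinalities with one known base. The first `r` rows and first `r` columns are
independent for the same reason, being a union of hooks, and adding any further position completes
an `(r + 1) × (r + 1)` grid, whose minor is a relation (`determinantalMatroid_isBase_hooks`). Both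
sets miss exactly `(m - r) * (n - r)` positions. Diagonal paths become anti-diagonal paths under
reversal of the columns, which preserves independence.
-/

/-! ### Leading monomials for a weight -/

section LeadingMonomial

variable {k τ : Type*} [Field k]

open scoped Classical in
/-- `d` is the leading monomial of `f` for the weight `wt`, with coefficient `1`: every other
monomial of `f` has strictly smaller weight than `d`. -/
def HasLeadingMonomial (wt : τ → ℕ) (f : MvPolynomial τ k) (d : τ →₀ ℕ) : Prop :=
  ∀ e, Finsupp.weight wt d ≤ Finsupp.weight wt e → coeff e f = if e = d then 1 else 0

theorem HasLeadingMonomial.one (wt : τ → ℕ) :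
    HasLeadingMonomial wt (1 : MvPolynomial τ k) 0 := by
  classical
  intro e _
  rw [coeff_one]
  simp only [eq_comm]

theorem HasLeadingMonomial.mul {wt : τ → ℕ} {f g : MvPolynomial τ k} {d e : τ →₀ ℕ}
    (hf : HasLeadingMonomial wt f d) (hg : HasLeadingMonomial wt g e) :
    HasLeadingMonomial wt (f * g) (d + e) := by
  classical
  intro x hx
  rw [coeff_mul]
  have key : ∀ y ∈ Finset.HasAntidiagonal.antidiagonal x,
      coeff y.1 f * coeff y.2 g = if y = (d, e) then 1 else 0 := by
    rintro ⟨y, z⟩ hyz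
    rw [Finset.HasAntidiagonal.mem_antidiagonal] at hyz
    simp only at hyz
    rw [← hyz, map_add, map_add] at hx
    simp only [Prod.mk.injEq]
    rcases lt_trichotomy (Finsupp.weight wt y) (Finsupp.weight wt d) with h | h | h
    · have hy : y ≠ d := by rintro rfl; exact h.false
      have hz : z ≠ e := by rintro rfl; omega
      rw [hg z (by omega), if_neg hz, if_neg (fun h => hy h.1), mul_zero]
    · rw [hf y h.ge, hg z (by omega)]
      split_ifs <;> simp_all
    · have hy : y ≠ d := by rintro rfl; exact h.false
      rw [hf y h.le, if_neg hy, if_neg (fun h => hy h.1), zero_mul]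
  rw [Finset.sum_congr rfl key, Finset.sum_ite_eq']
  simp only [Finset.HasAntidiagonal.mem_antidiagonal, eq_comm]

theorem HasLeadingMonomial.pow {wt : τ → ℕ} {f : MvPolynomial τ k} {d : τ →₀ ℕ}
    (hf : HasLeadingMonomial wt f d) (a : ℕ) : HasLeadingMonomial wt (f ^ a) (a • d) := by
  induction a with
  | zero => simpa using HasLeadingMonomial.one wt
  | succ a ih => rw [pow_succ, succ_nsmul]; exact ih.mul hf

theorem HasLeadingMonomial.prod {ι : Type*} {wt : τ → ℕ} {f : ι → MvPolynomial τ k}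
    {d : ι → τ →₀ ℕ} (s : Finset ι) (h : ∀ i, HasLeadingMonomial wt (f i) (d i)) :
    HasLeadingMonomial wt (∏ i ∈ s, f i) (∑ i ∈ s, d i) := by
  classical
  induction s using Finset.induction_on with
  | empty => simpa using HasLeadingMonomial.one wt
  | insert i s hi ih => rw [Finset.prod_insert hi, Finset.sum_insert hi]; exact (h i).mul ih

/-- Polynomials with leading monomials are algebraically independent as soon as these monomials
are. -/
theorem algebraicIndependent_of_hasLeadingMonomial {ι : Type*} [Fintype ι] {wt : τ → ℕ}
    {f : ι → MvPolynomial τ k} {d : ι → τ →₀ ℕ} (h : ∀ i, HasLeadingMonomial wt (f i) (d i))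
    (hinj : Function.Injective fun e : ι →₀ ℕ => ∑ i, e i • d i) :
    AlgebraicIndependent k f := by
  rw [algebraicIndependent_iff]
  intro p hp
  by_contra h0
  -- Among the exponents of `p`, take one whose product has the leading monomial of largest weight.
  obtain ⟨e, he, hmax⟩ := Finset.exists_max_image p.support
    (fun e => Finsupp.weight wt (∑ i, e i • d i)) (support_nonempty.2 h0)
  have h1 : coeff (∑ i, e i • d i) (aeval f p) = coeff e p := by
    rw [aeval_def, eval₂_eq', coeff_sum, Finset.sum_eq_single e]
    · rw [algebraMap_eq, coeff_C_mul,
        HasLeadingMonomial.prod Finset.univ (fun i => (h i).pow (e i)) _ le_rfl, if_pos rfl, mul_one]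
    · intro e' he' hne
      rw [algebraMap_eq, coeff_C_mul,
        HasLeadingMonomial.prod Finset.univ (fun i => (h i).pow (e' i)) _ (hmax e' he'),
        if_neg (fun h => hne (hinj h).symm), mul_zero]
    · intro h; exact absurd he h
  rw [hp, coeff_zero] at h1
  exact mem_support_iff.1 he h1.symm

end LeadingMonomial

/-! ### Independence of a union of separated chains -/

section Independence

variable {r m n : ℕ}

/-- The exponent of the monomial `a_il * b_lj`, the `l`-th summand of the entry `w = (i, j)` of the
generic product. -/
noncomputable def productExponent (w : Fin m × Fin n) (l : Fin r) :
    (Fin m × Fin r) ⊕ (Fin r × Fin n) →₀ ℕ :=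
  Finsupp.single (Sum.inl (w.1, l)) 1 + Finsupp.single (Sum.inr (l, w.2)) 1

theorem genericProduct_eq_sum_monomial (k : Type*) [Field k] (w : Fin m × Fin n) :
    genericProduct k r m n w.1 w.2 = ∑ l, monomial (productExponent w l) (1 : k) := by
  rw [genericProduct, Matrix.mul_apply]
  refine Finset.sum_congr rfl fun l _ => ?_
  rw [genericLeft, genericRight, Matrix.of_apply, Matrix.of_apply, X, X, monomial_mul, one_mul,
    productExponent]

/-- The weight attached to thresholds `c s i`: the `l`-th summand of the entry `(i, j)` of the
generic product gets the weight `∑ s, if l ≤ s then 2 * c s i else 2 * j + 1`. -/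
def thresholdWeight (c : Fin r → Fin m → ℕ) : (Fin m × Fin r) ⊕ (Fin r × Fin n) → ℕ :=
  Sum.elim (fun x => ∑ s, if x.2 ≤ s then 2 * c s x.1 else 0)
    (fun x => ∑ s, if x.1 ≤ s then 0 else 2 * (x.2 : ℕ) + 1)

theorem weight_productExponent (c : Fin r → Fin m → ℕ) (w : Fin m × Fin n) (l : Fin r) :
    Finsupp.weight (thresholdWeight c) (productExponent w l) =
      ∑ s, if l ≤ s then 2 * c s w.1 else 2 * (w.2 : ℕ) + 1 := by
  rw [productExponent, map_add, Finsupp.weight_single, Finsupp.weight_single, one_smul, one_smul]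
  simp only [thresholdWeight, Sum.elim_inl, Sum.elim_inr]
  rw [← Finset.sum_add_distrib]
  refine Finset.sum_congr rfl fun s _ => ?_
  split_ifs <;> simp

/-- If, for every `s`, the entry `w` lies to the left of the `s`-th threshold exactly when `t ≤ s`,
then `a_it * b_tj` maximizes every term of the weight, so it is the leading monomial. -/
theorem hasLeadingMonomial_genericProduct (k : Type*) [Field k] {c : Fin r → Fin m → ℕ}
    {w : Fin m × Fin n} {t : Fin r} (hc : ∀ s, (w.2 : ℕ) < c s w.1 ↔ t ≤ s) :
    HasLeadingMonomial (thresholdWeight c) (genericProduct k r m n w.1 w.2)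
      (productExponent w t) := by
  classical
  have hlt : ∀ l, l ≠ t → Finsupp.weight (thresholdWeight c) (productExponent w l) <
      Finsupp.weight (thresholdWeight c) (productExponent w t) := by
    intro l hl
    rw [weight_productExponent, weight_productExponent]
    refine Finset.sum_lt_sum (fun s _ => ?_) ⟨min l t, Finset.mem_univ _, ?_⟩
    · have := hc s
      by_cases hls : l ≤ s <;> by_cases hts : t ≤ s <;>
        simp only [hls, hts, if_true, if_false, iff_true, iff_false] at this ⊢ <;> omega
    · have := hc (min l t)
      rcases lt_or_gt_of_ne hl with h | h
      · rw [min_eq_left h.le, if_neg h.not_ge] at *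
        rw [if_pos le_rfl]
        have := mt this.1 h.not_ge
        omega
      · rw [min_eq_right h.le, if_pos le_rfl] at *
        rw [if_neg h.not_ge]
        have := this.2 le_rfl
        omega
  intro e he
  rw [genericProduct_eq_sum_monomial, coeff_sum, Finset.sum_eq_single t]
  · rw [coeff_monomial]; simp only [eq_comm]; congr
  · intro l _ hl
    rw [coeff_monomial, if_neg]
    rintro rfl
    exact (hlt l hl).not_ge he
  · intro h; exact absurd (Finset.mem_univ t) h

/-- The monomials `a_it * b_tj`, with `t` the label of `(i, j)`, are independent if the points with
equal labels form chains: a point of a chain cannot have both a later point of its row and a later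
point of its column in the chain, so the exponents can be recovered one at a time. -/
theorem injective_sum_smul_productExponent {Ω : Set (Fin m × Fin n)} [Fintype Ω] (t : Ω → Fin r)
    (hchain : ∀ v w : Ω, t v = t w → antiDiagonalLE v.1 w.1 ∨ antiDiagonalLE w.1 v.1) :
    Function.Injective fun e : Ω →₀ ℕ => ∑ w, e w • productExponent w.1 (t w) := by
  classical
  intro e e' h
  by_contra hne
  have hS : (Finset.univ.filter fun w : Ω => e w ≠ e' w).Nonempty := by
    by_contra hS
    rw [Finset.not_nonempty_iff_eq_empty, Finset.filter_eq_empty_iff] at hS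
    exact hne (Finsupp.ext fun w => not_not.1 (hS (Finset.mem_univ w)))
  obtain ⟨w, hw, hmin⟩ := Finset.exists_min_image _
    (fun w : Ω => (w.1.1 : ℕ) + (n - (w.1.2 : ℕ))) hS
  have hw' : e w ≠ e' w := (Finset.mem_filter.1 hw).2
  have hmin' : ∀ v : Ω, e v ≠ e' v →
      (w.1.1 : ℕ) + (n - (w.1.2 : ℕ)) ≤ (v.1.1 : ℕ) + (n - (v.1.2 : ℕ)) := fun v hv =>
    hmin v (Finset.mem_filter.2 ⟨Finset.mem_univ _, hv⟩)
  have eval : ∀ x, ∑ v, e v * productExponent v.1 (t v) x =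
      ∑ v, e' v * productExponent v.1 (t v) x := fun x => by
    have := DFunLike.congr_fun h x
    simpa [Finsupp.finsetSum_apply] using this
  -- If all other points in the sum for `x` have equal exponents, so does `w`.
  have single : ∀ x, productExponent w.1 (t w) x ≠ 0 →
      (∃ v, v ≠ w ∧ e v ≠ e' v ∧ productExponent v.1 (t v) x ≠ 0) := by
    intro x hx
    by_contra! hall
    have h1 := eval x
    rw [← Finset.add_sum_erase _ _ (Finset.mem_univ w),
      ← Finset.add_sum_erase _ (fun v => e' v * _) (Finset.mem_univ w),
      Finset.sum_congr rfl (g := fun v => e' v * productExponent v.1 (t v) x)] at h1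
    · exact hw' (Nat.eq_of_mul_eq_mul_right (Nat.pos_of_ne_zero hx) (Nat.add_right_cancel h1))
    · intro v hv
      by_cases hv' : e v = e' v
      · rw [hv']
      · rw [hall v (Finset.ne_of_mem_erase hv) hv', mul_zero, mul_zero]
  obtain ⟨v, hvw, hv, hvx⟩ := single (Sum.inl (w.1.1, t w)) (by simp [productExponent])
  obtain ⟨u, huw, hu, hux⟩ := single (Sum.inr (t w, w.1.2)) (by simp [productExponent])
  have hv1 : v.1.1 = w.1.1 ∧ t v = t w := by
    by_contra hn
    apply hvx
    simp [productExponent, hn]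
  have hu1 : t u = t w ∧ u.1.2 = w.1.2 := by
    by_contra hn
    apply hux
    simp [productExponent, hn]
  have hv2 : (v.1.2 : ℕ) ≠ w.1.2 := fun hh => hvw (Subtype.ext (Prod.ext hv1.1 (Fin.ext hh)))
  have hu2 : (u.1.1 : ℕ) ≠ w.1.1 := fun hh => huw (Subtype.ext (Prod.ext (Fin.ext hh) hu1.2))
  have hmv := hmin' v hv
  have hmu := hmin' u hu
  have e1 : (v.1.1 : ℕ) = w.1.1 := congrArg _ hv1.1
  have e2 : (u.1.2 : ℕ) = w.1.2 := congrArg _ hu1.2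
  have := u.1.2.isLt
  have := v.1.2.isLt
  have := w.1.2.isLt
  rcases hchain u v (hu1.1.trans hv1.2.symm) with ⟨h1, h2⟩ | ⟨h1, h2⟩ <;>
    rw [Fin.le_def] at h1 h2 <;> omega

/-- A union of chains `P t` is independent if thresholds `c s` exist, such that the points of `P t`
lie to the left of the threshold `c s` exactly when `t ≤ s`. -/
theorem determinantalMatroid_indep_iUnion (k : Type*) [Field k]
    (P : Fin r → Set (Fin m × Fin n)) (c : Fin r → Fin m → ℕ)
    (hc : ∀ t, ∀ w ∈ P t, ∀ s, (w.2 : ℕ) < c s w.1 ↔ t ≤ s)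
    (hchain : ∀ t, ∀ v ∈ P t, ∀ w ∈ P t, antiDiagonalLE v w ∨ antiDiagonalLE w v) :
    (determinantalMatroid k r m n).Indep (⋃ t, P t) := by
  classical
  rw [determinantalMatroid_indep_iff, eliminationIdeal_eq_bot_iff]
  have hmem : ∀ w : ↥(⋃ t, P t), ∃ t, w.1 ∈ P t := fun w => Set.mem_iUnion.1 w.2
  choose t ht using hmem
  have : Fintype ↥(⋃ t, P t) := Fintype.ofFinite _
  refine algebraicIndependent_of_hasLeadingMonomial (wt := thresholdWeight c)
    (d := fun w => productExponent w.1 (t w))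
    (fun w => hasLeadingMonomial_genericProduct k (hc _ _ (ht w)))
    (injective_sum_smul_productExponent t fun v w hvw => hchain (t v) _ (ht v) _ ?_)
  rw [hvw]
  exact ht w

end Independence

/-! ### Lattice paths -/

section Paths

variable {m n : ℕ} {a b a' b' : Fin m × Fin n} {C C' : Set (Fin m × Fin n)}

theorem IsAntiDiagonalPath.total (h : IsAntiDiagonalPath a b C) {v w : Fin m × Fin n}
    (hv : v ∈ C) (hw : w ∈ C) : antiDiagonalLE v w ∨ antiDiagonalLE w v := by
  by_cases hvw : v = w
  · subst hvw; exact Or.inl ⟨le_rfl, le_rfl⟩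
  · exact h.1.1 hv hw hvw

/-- A maximal chain in the grid proceeds by unit steps. -/
theorem IsAntiDiagonalPath.exists_pred (h : IsAntiDiagonalPath a b C) {c : Fin m × Fin n}
    (hc : c ∈ C) (hca : c ≠ a) :
    ∃ q ∈ C, ((q.1 : ℕ) + 1 = c.1 ∧ (q.2 : ℕ) = c.2) ∨ ((q.1 : ℕ) = c.1 ∧ (q.2 : ℕ) = c.2 + 1) := by
  classical
  have hab := h.1
  -- `p` is the largest point of the chain below `c`.
  obtain ⟨p, hp, hmax⟩ := Finset.exists_max_image
    (Finset.univ.filter fun p => p ∈ C ∧ antiDiagonalLE p c ∧ p ≠ c)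
    (fun p => (p.1 : ℕ) + (n - (p.2 : ℕ)))
    ⟨a, by simpa using ⟨hab.2.1, (hab.2.2.2 c hc).1, hca.symm⟩⟩
  simp only [Finset.mem_filter, Finset.mem_univ, true_and] at hp hmax
  obtain ⟨hpC, hpc, hne⟩ := hp
  have hsplit : ∀ x ∈ C, antiDiagonalLE x p ∨ antiDiagonalLE c x := by
    intro x hx
    by_cases hcx : antiDiagonalLE c x
    · exact Or.inr hcx
    left
    have hxc : antiDiagonalLE x c := (h.total hx hc).resolve_right hcx
    have hxne : x ≠ c := by rintro rfl; exact hcx ⟨le_rfl, le_rfl⟩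
    have h1 := hmax x ⟨hx, hxc, hxne⟩
    rcases h.total hx hpC with h2 | h2
    · exact h2
    · obtain ⟨h3, h4⟩ := h2
      rw [Fin.le_def] at h3 h4
      have := x.2.isLt
      have := p.2.isLt
      exact ⟨by rw [Fin.le_def]; omega, by rw [Fin.le_def]; omega⟩
  -- A point between `p` and `c` can be added to the chain, so it is in the chain.
  have key : ∀ q, antiDiagonalLE p q → antiDiagonalLE q c → q ∈ C := by
    intro q hpq hqc
    have hins : IsChainFromTo antiDiagonalLE a b (insert q C) := by
      refine ⟨hab.1.insert fun x hx _ => ?_, Set.mem_insert_of_mem _ hab.2.1,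
        Set.mem_insert_of_mem _ hab.2.2.1, ?_⟩
      · rcases hsplit x hx with h1 | h1
        · exact Or.inr ⟨h1.1.trans hpq.1, hpq.2.trans h1.2⟩
        · exact Or.inl ⟨hqc.1.trans h1.1, h1.2.trans hqc.2⟩
      · intro x hx
        rcases Set.mem_insert_iff.1 hx with rfl | hx
        · have h1 := (hab.2.2.2 p hpC).1
          have h2 := (hab.2.2.2 c hc).2
          exact ⟨⟨h1.1.trans hpq.1, hpq.2.trans h1.2⟩, ⟨hqc.1.trans h2.1, h2.2.trans hqc.2⟩⟩
        · exact hab.2.2.2 x hx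
    exact h.2 hins (Set.subset_insert q C) (Set.mem_insert q C)
  obtain ⟨h1, h2⟩ := hpc
  rw [Fin.le_def] at h1 h2
  by_cases h3 : (p.1 : ℕ) = c.1
  · have h4 : (p.2 : ℕ) ≠ c.2 := fun h4 => hne (Prod.ext (Fin.ext h3) (Fin.ext h4))
    have := p.2.isLt
    refine ⟨(c.1, ⟨c.2 + 1, by omega⟩), key _ ⟨?_, ?_⟩ ⟨?_, ?_⟩, Or.inr ⟨rfl, rfl⟩⟩ <;>
      rw [Fin.le_def] <;> simp only <;> omega
  · have := c.1.isLt
    refine ⟨(⟨c.1 - 1, by omega⟩, c.2), key _ ⟨?_, ?_⟩ ⟨?_, ?_⟩, Or.inl ⟨?_, rfl⟩⟩ <;>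
      (try rw [Fin.le_def]) <;> simp only <;> omega

/-- A path meets every row between those of its endpoints. -/
theorem IsAntiDiagonalPath.exists_mem_row (h : IsAntiDiagonalPath a b C) {i : Fin m}
    (hai : a.1 ≤ i) (hib : i ≤ b.1) : ∃ j, (i, j) ∈ C := by
  classical
  obtain ⟨p, hp, hmin⟩ := Finset.exists_min_image
    (Finset.univ.filter fun p => p ∈ C ∧ i ≤ p.1)
    (fun p => (p.1 : ℕ) + (n - (p.2 : ℕ))) ⟨b, by simpa using ⟨h.1.2.2.1, hib⟩⟩
  simp only [Finset.mem_filter, Finset.mem_univ, true_and] at hp hmin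
  have hpi : p.1 = i := by
    by_cases hpa : p = a
    · subst hpa; exact le_antisymm hai hp.2
    obtain ⟨q, hq, hqp⟩ := h.exists_pred hp.1 hpa
    have h1 := hmin q
    have h2 := hp.2
    have := p.2.isLt
    have := q.2.isLt
    rw [Fin.le_def] at h1 h2
    by_contra hne
    have h3 : (p.1 : ℕ) ≠ i := fun hh => hne (Fin.ext hh)
    have h4 := h1 ⟨hq, by omega⟩
    omega
  refine ⟨p.2, ?_⟩
  rw [← hpi]
  exact hp.1

/-- A path from `a` to `b` has one point at each height between those of `a` and `b`. -/
theorem IsAntiDiagonalPath.ncard_eq (h : IsAntiDiagonalPath a b C) :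
    C.ncard = ((b.1 : ℕ) - a.1) + ((a.2 : ℕ) - b.2) + 1 := by
  classical
  let φ : Fin m × Fin n → ℕ := fun p => (p.1 : ℕ) + (n - (p.2 : ℕ))
  have hinj : Set.InjOn φ C := by
    intro x hx y hy hxy
    simp only [φ] at hxy
    have := x.2.isLt
    have := y.2.isLt
    apply Prod.ext <;> apply Fin.ext <;> rcases h.total hx hy with ⟨h1, h2⟩ | ⟨h1, h2⟩ <;>
      rw [Fin.le_def] at h1 h2 <;> omega
  have himage : φ '' C = Set.Icc (φ a) (φ b) := by
    apply Set.Subset.antisymm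
    · rintro _ ⟨x, hx, rfl⟩
      obtain ⟨⟨h1, h2⟩, h3, h4⟩ := h.1.2.2.2 x hx
      rw [Fin.le_def] at h1 h2 h3 h4
      simp only [φ, Set.mem_Icc]
      omega
    · intro v hv
      have step : ∀ d, φ a + d ≤ φ b → φ b - d ∈ φ '' C := by
        intro d
        induction d with
        | zero => intro _; exact ⟨b, h.1.2.2.1, rfl⟩
        | succ d ih =>
          intro hd
          obtain ⟨x, hx, hxd⟩ := ih (by omega)
          have hxa : x ≠ a := by rintro rfl; omega
          obtain ⟨q, hq, hqx⟩ := h.exists_pred hx hxa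
          refine ⟨q, hq, ?_⟩
          have := x.2.isLt
          have := q.2.isLt
          have h2 : φ q + 1 = φ x := by simp only [φ]; omega
          omega
      have := step (φ b - v) (by have := hv.1; have := hv.2; omega)
      rwa [Nat.sub_sub_self hv.2] at this
  rw [← hinj.ncard_image, himage, ← Finset.coe_Icc, Set.ncard_coe_finset, Nat.card_Icc]
  obtain ⟨h1, h2⟩ := (h.1.2.2.2 a h.1.2.1).2
  rw [Fin.le_def] at h1 h2
  simp only [φ]
  have := a.2.isLt
  omega

/-- A path that starts further down on the right-hand side, and is disjoint from another path, stays
on the lower right of it: a step down or to the left cannot cross the other path. -/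
theorem IsAntiDiagonalPath.not_le_of_disjoint (h : IsAntiDiagonalPath a b C)
    (h' : IsAntiDiagonalPath a' b' C') (hd : Disjoint C C') (h1 : a.1 ≤ a'.1) (h2 : a.2 ≤ a'.2)
    (h3 : b'.1 ≤ b.1) {p q : Fin m × Fin n} (hp : p ∈ C') (hq : q ∈ C) : ¬diagonalLE p q := by
  suffices H : ∀ N, ∀ p ∈ C', (p.1 : ℕ) + (n - (p.2 : ℕ)) = N → ∀ q ∈ C, ¬diagonalLE p q from
    H _ p hp rfl q hq
  intro N
  induction N using Nat.strong_induction_on with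
  | _ N ih =>
  rintro p hp hpN q hq ⟨hpq1, hpq2⟩
  obtain ⟨hap, hpb⟩ := h'.1.2.2.2 p hp
  obtain ⟨j, hj⟩ : ∃ j, (p.1, j) ∈ C := h.exists_mem_row (h1.trans hap.1) (hpb.1.trans h3)
  -- The point of `C` in the row of `p` may be taken on the right of `p`.
  obtain ⟨j, hj, hpj⟩ : ∃ j, (p.1, j) ∈ C ∧ p.2 ≤ j := by
    rcases h.total hj hq with h4 | h4
    · exact ⟨j, hj, hpq2.trans h4.2⟩
    · refine ⟨q.2, ?_, hpq2⟩
      rw [le_antisymm hpq1 h4.1]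
      exact hq
  have hne : (p.2 : ℕ) ≠ j := by
    intro hpj'
    have : p = (p.1, j) := Prod.ext rfl (Fin.ext hpj')
    exact Set.disjoint_left.1 hd hj (this ▸ hp)
  have hja : j ≤ a.2 := (h.1.2.2.2 _ hj).1.2
  rw [Fin.le_def] at hpj hja h2
  have hpa : p ≠ a' := by rintro rfl; omega
  obtain ⟨x, hx, hxp⟩ := h'.exists_pred hp hpa
  have := x.2.isLt
  have := p.2.isLt
  refine ih _ ?_ x hx rfl _ hj ⟨?_, ?_⟩
  · omega
  · rw [Fin.le_def]; simp only; omega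
  · rw [Fin.le_def]; simp only; omega

end Paths

/-! ### Families of disjoint anti-diagonal paths -/

section Families

variable {r m n : ℕ}

theorem determinantalMatroid_indep_of_antiDiagonalPaths (k : Type*) [Field k]
    (hm : r ≤ m) (hn : r ≤ n) (σ : Equiv.Perm (Fin r)) (P : Fin r → Set (Fin m × Fin n))
    (hP : ∀ i, IsAntiDiagonalPath (antiDiagonalSource hm hn i) (antiDiagonalTarget hm hn (σ i)) (P i))
    (hd : ∀ i j, i ≠ j → Disjoint (P i) (P j)) :
    (determinantalMatroid k r m n).Indep (⋃ i, P i) := by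
  classical
  have hbelow : ∀ s t, s < t → ∀ p ∈ P t, ∀ q ∈ P s, ¬diagonalLE p q := fun s t hst p hp q hq =>
    (hP s).not_le_of_disjoint (hP t) (hd s t hst.ne) hst.le le_rfl le_rfl hp hq
  have hlast : ∀ p : Fin m × Fin n, ∀ i, p.2 ≤ (antiDiagonalSource hm hn i).2 := fun p i => by
    have := p.2.isLt
    rw [Fin.le_def]; simp only [antiDiagonalSource]; omega
  have habove : ∀ s t, t ≤ s → ∀ p ∈ P t, ∃ q ∈ P s, diagonalLE p q := by
    intro s t hts p hp
    rcases hts.eq_or_lt with rfl | hts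
    · exact ⟨p, hp, le_rfl, le_rfl⟩
    rcases le_total p.1 (antiDiagonalSource hm hn s).1 with h1 | h1
    · exact ⟨_, (hP s).1.2.1, h1, hlast p s⟩
    · obtain ⟨j, hj⟩ := (hP s).exists_mem_row h1 ((hP t).1.2.2.2 p hp).2.1
      refine ⟨_, hj, le_rfl, le_of_not_ge fun hjp => hbelow t s hts _ hj p hp ⟨le_rfl, hjp⟩⟩
  -- The threshold `c s i` is the length of row `i` in the region on the upper left of `P s`.
  refine determinantalMatroid_indep_iUnion k P
    (fun s i => (Finset.univ.filter fun j => ∃ q ∈ P s, diagonalLE (i, j) q).sup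
      fun j => (j : ℕ) + 1) ?_ (fun t v hv w hw => (hP t).total hv hw)
  intro t w hw s
  rw [Finset.lt_sup_iff]
  constructor
  · rintro ⟨j, hj, hwj⟩
    obtain ⟨q, hq, hjq⟩ := (Finset.mem_filter.1 hj).2
    by_contra hts
    refine hbelow s t (not_le.1 hts) w hw q hq ⟨hjq.1, le_trans ?_ hjq.2⟩
    rw [Fin.le_def]; simp only; omega
  · intro hts
    exact ⟨w.2, Finset.mem_filter.2 ⟨Finset.mem_univ _, habove s t hts w hw⟩, Nat.lt_succ_self _⟩

theorem ncard_iUnion_antiDiagonalPaths (hm : r ≤ m) (hn : r ≤ n) (σ : Equiv.Perm (Fin r))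
    (P : Fin r → Set (Fin m × Fin n))
    (hP : ∀ i, IsAntiDiagonalPath (antiDiagonalSource hm hn i) (antiDiagonalTarget hm hn (σ i)) (P i))
    (hd : ∀ i j, i ≠ j → Disjoint (P i) (P j)) :
    (⋃ i, P i).ncard + (m - r) * (n - r) = m * n := by
  rw [Set.ncard_iUnion_of_finite (fun i => Set.toFinite _) (fun i j hij => hd i j hij),
    finsum_eq_sum_of_fintype]
  have h1 : ∀ i, (P i).ncard = (m - 1 - (i : ℕ) + 1) + (n - 1 - ((σ i : Fin r) : ℕ)) := fun i => by
    rw [(hP i).ncard_eq]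
    simp only [antiDiagonalSource, antiDiagonalTarget]
    omega
  rw [Finset.sum_congr rfl fun i _ => h1 i, Finset.sum_add_distrib,
    Equiv.sum_comp σ fun i : Fin r => n - 1 - (i : ℕ), ← Finset.sum_add_distrib,
    Fin.sum_univ_eq_sum_range (fun i => (m - 1 - i + 1) + (n - 1 - i)) r]
  clear h1 hd hP P σ
  induction r with
  | zero => simp
  | succ r ih =>
    rw [← ih (by omega) (by omega), Finset.sum_range_succ]
    obtain ⟨x, rfl⟩ := Nat.exists_eq_add_of_le hm
    obtain ⟨y, rfl⟩ := Nat.exists_eq_add_of_le hn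
    rw [show r + 1 + x - 1 - r = x by omega, show r + 1 + y - 1 - r = y by omega,
      show r + 1 + x - (r + 1) = x by omega, show r + 1 + y - (r + 1) = y by omega,
      show r + 1 + x - r = x + 1 by omega, show r + 1 + y - r = y + 1 by omega]
    ring

end Families

/-! ### The rank of the determinantal matroid -/

section Rank

variable {r m n : ℕ}

/-- A set that contains a full `(r + 1) × (r + 1)` grid is dependent, by the minor of the grid. -/
theorem not_determinantalMatroid_indep_of_minor (k : Type*) [Field k] {Ω : Set (Fin m × Fin n)}
    (f : Fin (r + 1) ↪o Fin m) (g : Fin (r + 1) ↪o Fin n) (h : ∀ i j, (f i, g j) ∈ Ω) :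
    ¬(determinantalMatroid k r m n).Indep Ω := by
  rw [determinantalMatroid_indep_iff]
  intro hbot
  let ι : Fin (r + 1) × Fin (r + 1) → Ω := fun x => ⟨(f x.1, g x.2), h x.1 x.2⟩
  have hι : Function.Injective ι := by
    rintro ⟨x, y⟩ ⟨x', y'⟩ hxy
    simpa [ι] using hxy
  have hmem : rename ι (Matrix.mvPolynomialX (Fin (r + 1)) (Fin (r + 1)) k).det ∈
      eliminationIdeal k r m n Ω := by
    rw [eliminationIdeal, Ideal.mem_comap, rename_rename, AlgHom.map_det]
    refine Ideal.subset_span ⟨f, g, congrArg Matrix.det ?_⟩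
    ext1 i j
    simp [genericMatrix, ι]
  rw [hbot, Ideal.mem_bot, map_eq_zero_iff _ (rename_injective ι hι)] at hmem
  exact Matrix.det_mvPolynomialX_ne_zero _ k hmem

/-- The first `r` rows together with the first `r` columns form a base. -/
theorem determinantalMatroid_isBase_hooks (k : Type*) [Field k] (r m n : ℕ) :
    (determinantalMatroid k r m n).IsBase {w | (w.1 : ℕ) < r ∨ (w.2 : ℕ) < r} := by
  have hU : {w : Fin m × Fin n | (w.1 : ℕ) < r ∨ (w.2 : ℕ) < r} =
      ⋃ t : Fin r, {w | min (w.1 : ℕ) w.2 = t} := by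
    ext w
    simp only [Set.mem_ofPred_eq, Set.mem_iUnion]
    constructor
    · intro h
      exact ⟨⟨min w.1 w.2, by omega⟩, rfl⟩
    · rintro ⟨t, ht⟩
      have := t.isLt
      omega
  refine Matroid.Indep.isBase_of_forall_insert ?_ ?_
  · rw [hU]
    refine determinantalMatroid_indep_iUnion k _
      (fun s i => if (i : ℕ) ≤ s then n else s + 1) ?_ ?_
    · intro t w hw s
      have := w.2.isLt
      simp only [Set.mem_ofPred_eq] at hw
      rw [Fin.le_def]
      split_ifs <;> omega
    · intro t v hv w hw
      simp only [Set.mem_ofPred_eq] at hv hw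
      simp only [antiDiagonalLE, Fin.le_def]
      omega
  · rintro ⟨i, j⟩ ⟨-, he⟩
    simp only [Set.mem_ofPred_eq, not_or, not_lt] at he
    obtain ⟨hi, hj⟩ := he
    have hmono : ∀ {N : ℕ} (x : Fin N) (hx : r ≤ x),
        StrictMono (fun a : Fin (r + 1) => if h : (a : ℕ) < r then ⟨a, by omega⟩ else x) := by
      intro N x hx a b hab
      have := a.isLt
      have := b.isLt
      rw [Fin.lt_def] at hab
      dsimp only
      split_ifs <;> rw [Fin.lt_def] <;> (try simp only) <;> omega
    refine not_determinantalMatroid_indep_of_minor k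
      (OrderEmbedding.ofStrictMono _ (hmono i hi)) (OrderEmbedding.ofStrictMono _ (hmono j hj)) ?_
    intro a b
    simp only [OrderEmbedding.coe_ofStrictMono, Set.mem_insert_iff, Set.mem_ofPred_eq]
    split_ifs <;> simp_all

theorem ncard_hooks (hm : r ≤ m) (hn : r ≤ n) :
    {w : Fin m × Fin n | (w.1 : ℕ) < r ∨ (w.2 : ℕ) < r}.ncard + (m - r) * (n - r) = m * n := by
  classical
  have hcompl : {w : Fin m × Fin n | (w.1 : ℕ) < r ∨ (w.2 : ℕ) < r}ᶜ =
      {i : Fin m | r ≤ (i : ℕ)} ×ˢ {j : Fin n | r ≤ (j : ℕ)} := by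
    ext w
    simp
  have hcard : ∀ {N : ℕ}, r ≤ N → {i : Fin N | r ≤ (i : ℕ)}.ncard = N - r := by
    intro N hN
    rw [← Set.ncard_image_of_injective _ Fin.val_injective]
    have : Fin.val '' {i : Fin N | r ≤ (i : ℕ)} = Set.Ico r N := by
      ext x
      constructor
      · rintro ⟨i, hi, rfl⟩; exact ⟨hi, i.isLt⟩
      · rintro ⟨h1, h2⟩; exact ⟨⟨x, h2⟩, h1, rfl⟩
    rw [this, ← Finset.coe_Ico, Set.ncard_coe_finset, Nat.card_Ico]
  have := Set.ncard_add_ncard_compl {w : Fin m × Fin n | (w.1 : ℕ) < r ∨ (w.2 : ℕ) < r}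
  rw [hcompl, Set.ncard_prod, hcard hm, hcard hn] at this
  simpa using this

theorem determinantalMatroid_isBase_of_indep_of_ncard (k : Type*) [Field k] (hm : r ≤ m)
    (hn : r ≤ n) {Ω : Set (Fin m × Fin n)} (h : (determinantalMatroid k r m n).Indep Ω)
    (hcard : Ω.ncard + (m - r) * (n - r) = m * n) :
    (determinantalMatroid k r m n).IsBase Ω := by
  obtain ⟨B, hB, hΩB⟩ := h.exists_isBase_superset
  have h1 := hB.ncard_eq_ncard_of_isBase (determinantalMatroid_isBase_hooks k r m n)
  have h2 := ncard_hooks hm hn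
  rwa [Set.eq_of_subset_of_ncard_le hΩB (by omega) (Set.toFinite B)]

end Rank

/-! ### Reversal of the columns -/

section Reversal

variable {r m n : ℕ}

/-- Reversal of the columns of the grid. -/
def reverseColumns (m n : ℕ) : Fin m × Fin n ≃ Fin m × Fin n :=
  Equiv.prodCongr (Equiv.refl _) Fin.revPerm

theorem determinantalMatroid_indep_of_preimage_reverseColumns (k : Type*) [Field k]
    {Ω : Set (Fin m × Fin n)}
    (h : (determinantalMatroid k r m n).Indep (reverseColumns m n ⁻¹' Ω)) :
    (determinantalMatroid k r m n).Indep Ω := by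
  rw [determinantalMatroid_indep_iff, eliminationIdeal_eq_bot_iff] at h ⊢
  -- Reversing the columns of the generic right factor reverses those of the generic product.
  let ρ : (Fin m × Fin r) ⊕ (Fin r × Fin n) → (Fin m × Fin r) ⊕ (Fin r × Fin n) :=
    Sum.map id (Prod.map id Fin.rev)
  have hρ : Function.Injective ρ :=
    Function.injective_id.sumMap (Function.injective_id.prodMap Fin.rev_injective)
  have h1 := h.map' (f := rename ρ) (rename_injective ρ hρ)
  let φ : Ω → ↥(reverseColumns m n ⁻¹' Ω) := fun w =>
    ⟨(reverseColumns m n).symm w.1, by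
      rw [Set.mem_preimage, Equiv.apply_symm_apply]; exact w.2⟩
  have hφ : Function.Injective φ := fun v w hvw =>
    Subtype.ext ((reverseColumns m n).symm.injective (congrArg Subtype.val hvw))
  convert! h1.comp φ hφ using 1
  funext w
  simp [φ, ρ, genericProduct, genericLeft, genericRight, Matrix.mul_apply, reverseColumns]

/-- Column reversal exchanges the two orders, so it carries diagonal to anti-diagonal paths. -/
theorem IsDiagonalPath.preimage_reverseColumns {a b : Fin m × Fin n} {C : Set (Fin m × Fin n)}
    (h : IsDiagonalPath a b C) :
    IsAntiDiagonalPath (reverseColumns m n a) (reverseColumns m n b)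
      (reverseColumns m n ⁻¹' C) := by
  have hinv : ∀ p, reverseColumns m n (reverseColumns m n p) = p := fun p => by
    exact Prod.ext rfl (Fin.rev_rev p.2)
  have hle : ∀ p q, antiDiagonalLE (reverseColumns m n p) (reverseColumns m n q) ↔
      diagonalLE p q := fun p q => by
    simp [antiDiagonalLE, diagonalLE, reverseColumns]
  have hle' : ∀ p q, diagonalLE (reverseColumns m n p) (reverseColumns m n q) ↔
      antiDiagonalLE p q := fun p q => by
    simp [antiDiagonalLE, diagonalLE, reverseColumns]
  have hmem : ∀ {D : Set (Fin m × Fin n)} p, p ∈ D ↔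
      reverseColumns m n p ∈ reverseColumns m n ⁻¹' D := fun p => by
    rw [Set.mem_preimage, hinv]
  have inj := (reverseColumns m n).injective
  constructor
  · refine ⟨fun x hx y hy hxy => ?_, (hmem a).1 h.1.2.1, (hmem b).1 h.1.2.2.1, fun c hc => ?_⟩
    · have := h.1.1 hx hy (inj.ne hxy)
      simpa only [hle'] using this
    · have := h.1.2.2.2 _ hc
      rwa [← hle, ← hle, hinv] at this
  · intro D hD hCD
    have hD' : IsChainFromTo diagonalLE a b (reverseColumns m n ⁻¹' D) := by
      refine ⟨fun x hx y hy hxy => ?_, hD.2.1, hD.2.2.1, fun c hc => ?_⟩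
      · have := hD.1 hx hy (inj.ne hxy)
        simpa only [hle] using this
      · have := hD.2.2.2 _ hc
        rwa [hle, hle] at this
    have := h.2 hD' fun x hx => hCD ((hmem x).1 hx)
    intro x hx
    exact this ((hmem x).1 hx)

end Reversal

theorem mainTheorem4 (k : Type*) [Field k] [Infinite k] (r m n : ℕ) (hm : r ≤ m) (hn : r ≤ n) :
    (∀ (σ : Equiv.Perm (Fin r)) (P : Fin r → Set (Fin m × Fin n)),
      (∀ i, IsAntiDiagonalPath (antiDiagonalSource hm hn i) (antiDiagonalTarget hm hn (σ i)) (P i)) →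
      (∀ i j, i ≠ j → Disjoint (P i) (P j)) →
      (determinantalMatroid k r m n).IsBase (⋃ i, P i)) ∧
    (∀ (σ : Equiv.Perm (Fin r)) (P : Fin r → Set (Fin m × Fin n)),
      (∀ i, IsDiagonalPath (diagonalSource hm hn i) (diagonalTarget hm hn (σ i)) (P i)) →
      (∀ i j, i ≠ j → Disjoint (P i) (P j)) →
      (determinantalMatroid k r m n).IsBase (⋃ i, P i)) := by
  refine ⟨fun σ P hP hd => ?_, fun σ P hP hd => ?_⟩
  · exact determinantalMatroid_isBase_of_indep_of_ncard k hm hn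
      (determinantalMatroid_indep_of_antiDiagonalPaths k hm hn σ P hP hd)
      (ncard_iUnion_antiDiagonalPaths hm hn σ P hP hd)
  · have hP' : ∀ i, IsAntiDiagonalPath (antiDiagonalSource hm hn i)
        (antiDiagonalTarget hm hn ((σ.trans Fin.revPerm) i)) (reverseColumns m n ⁻¹' P i) := by
      intro i
      have htarget : antiDiagonalTarget hm hn ((σ.trans Fin.revPerm) i) =
          reverseColumns m n (diagonalTarget hm hn (σ i)) := by
        refine Prod.ext rfl (Fin.ext ?_)
        change ((σ i).rev : ℕ) = (Fin.rev ⟨n - r + σ i, _⟩ : Fin n)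
        have := (σ i).isLt
        rw [Fin.val_rev, Fin.val_rev]
        simp only
        omega
      rw [htarget]
      exact (hP i).preimage_reverseColumns
    have hd' : ∀ i j, i ≠ j →
        Disjoint (reverseColumns m n ⁻¹' P i) (reverseColumns m n ⁻¹' P j) := fun i j hij =>
      (hd i j hij).preimage _
    have hU : ⋃ i, reverseColumns m n ⁻¹' P i = reverseColumns m n ⁻¹' ⋃ i, P i :=
      Set.preimage_iUnion.symm
    have hI := determinantalMatroid_indep_of_antiDiagonalPaths k hm hn _ _ hP' hd'
    have hcard := ncard_iUnion_antiDiagonalPaths hm hn _ _ hP' hd'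
    rw [hU] at hI hcard
    rw [Set.ncard_preimage_of_injective_subset_range (reverseColumns m n).injective
      (by simp)] at hcard
    exact determinantalMatroid_isBase_of_indep_of_ncard k hm hn
      (determinantalMatroid_indep_of_preimage_reverseColumns k hI) hcard
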